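/- Let $T_2(\mathbb{F}_q)$ be the group of invertible upper triangular $2\times 2$ matrices over the finite field $\mathbb{F}_q$ with $q$ elements, and let $U_2(\mathbb{F}_q)\leqslant T_2(\mathbb{F}_q)$ be the subgroup of matrices with $1$'s on the diagonal. For a subset $A$ of a group and $k\in\mathbb{N}$, let $A^k$ be the set of $k$-fold products of elements of $A$, and let $\langle A\rangle$ be the subgroup generated by $A$. A matrix is $\mathbb{F}^*$-potent if it equals $\lambda u$ with $\lambda\in\mathbb{F}_q^*$ and $u\in U_2(\mathbb{F}_q)$; an $\mathbb{F}^*$-potent group is the subgroup $H$ of $T_2(\mathbb{F}_q)$ that consists of all $\mathbb{F}^*$-potent matrices, i.e. $H=\left\{\begin{pmatrix}a&b\\0&a\end{pmatrix}: a\in\mathbb{F}_q^*,\ b\in\mathbb{F}_q\right\}$. Theorem. There are absolute constants $c>0$ and $C,m\in\mathbb{N}$ such that the following holds for every finite field $\mathbb{F}_q$, every real $K$ and every $A\subseteq T_2(\mathbb{F}_q)$. If $A$ contains the identity, $A=A^{-1}$ and $|A^3|\leqslant K|A|$, then either 1. there is an $\mathbb{F}^*$-potent group $H$ such that $|A^2\cap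 H|\geqslant cK^{-C}|A|$, or 2. there is a subgroup $U\leqslant U_2(\mathbb{F}_q)$ such that $U\subseteq A^m$, $U$ is normal in $\langle A\rangle$, and $\langle A\rangle/U$ is abelian. -/

import Mathlib

open scoped Pointwise MatrixGroups

/-- The group `T₂(F)` of invertible upper triangular `2 × 2` matrices over `F`. -/
def upperT2 (F : Type*) [Field F] : Subgroup (GL (Fin 2) F) where
  carrier := {g | (g : Matrix (Fin 2) (Fin 2) F) 1 0 = 0}
  one_mem' := by simp
  mul_mem' := by
    intro g h hg hh
    simp only [Set.mem_setOf_eq] at hg hh ⊢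
    simp [Matrix.mul_apply, Fin.sum_univ_two, hg, hh]
  inv_mem' := by
    intro g hg
    simp only [Set.mem_setOf_eq] at hg ⊢
    simp [Matrix.coe_units_inv, Matrix.inv_def, Matrix.adjugate_fin_two, hg]

/-- The unipotent subgroup `U₂(F)`: the upper triangular matrices with `1`'s on the diagonal. -/
def unipotentU2 (F : Type*) [Field F] : Subgroup (GL (Fin 2) F) where
  carrier := {g | g ∈ upperT2 F ∧ ∀ i, (g : Matrix (Fin 2) (Fin 2) F) i i = 1}
  one_mem' := ⟨one_mem _, by simp⟩
  mul_mem' := by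
    rintro g h ⟨hg, hg1⟩ ⟨hh, hh1⟩
    refine ⟨mul_mem hg hh, ?_⟩
    change (g : Matrix (Fin 2) (Fin 2) F) 1 0 = 0 at hg
    change (h : Matrix (Fin 2) (Fin 2) F) 1 0 = 0 at hh
    intro i
    fin_cases i
    · simpa [Matrix.mul_apply, Fin.sum_univ_two, hg, hh] using by
        rw [hg1 0, hh1 0, one_mul]
    · simpa [Matrix.mul_apply, Fin.sum_univ_two, hg, hh] using by
        rw [hg1 1, hh1 1, one_mul]
  inv_mem' := by
    rintro g ⟨hg, hg1⟩
    refine ⟨inv_mem hg, ?_⟩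
    change (g : Matrix (Fin 2) (Fin 2) F) 1 0 = 0 at hg
    have h0 := hg1 0
    have h1 := hg1 1
    intro i
    fin_cases i <;>
      simp [Matrix.coe_units_inv, Matrix.inv_def, Matrix.adjugate_fin_two, Matrix.det_fin_two,
        hg, h0, h1]

/-- A matrix is `F^*`-potent if it is `c • u` for a nonzero scalar `c` and a unipotent `u`. -/
def IsFStarPotent {F : Type*} [Field F] (g : GL (Fin 2) F) : Prop :=
  ∃ c : F, c ≠ 0 ∧ ∃ u ∈ unipotentU2 F,
    (g : Matrix (Fin 2) (Fin 2) F) = c • (u : Matrix (Fin 2) (Fin 2) F)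

/-- An `F^*`-potent group is the subgroup made up of all the `F^*`-potent matrices. -/
def IsFStarPotentGroup {F : Type*} [Field F] (H : Subgroup (GL (Fin 2) F)) : Prop :=
  (H : Set (GL (Fin 2) F)) = {g | IsFStarPotent g}

/-! The character χ = `diagRatio` on T₂ has the F^*-potent group as kernel, and conjugation by g
dilates the unipotent entry b to χ(g)b. Put X = χ(A) and B k = `unipotentEntries A k`. If A² has few
F^*-potent elements, then |X| > 2K^33 (`card_le_card_mul_card_image_diagRatio`), while small
tripling gives |B 34| ≤ K^33 |B 4| (`card_unipotentEntries_le`); hence 2|B 34| < |B 4||X|.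

This drives a sum-product pivot argument. For a non-pivot ξ, some dilate of B 4 + Xξ lies in B 34,
so ξ cannot be close to a pivot: non-pivots are stable under dilation by X and translation by B 4.
They therefore fill the whole group V spanned by the ⟨A⟩-orbit of B 4 (`orbitSpan_induction`).
Averaging over V finds a non-pivot ξ for which B 4 + Xξ has more than |V|/2 elements; a dilate of it
lies in V ∩ B 34, so V ⊆ B 68 (`mem_of_forall_isNonPivot`). The unipotent group over V is normal in
⟨A⟩ and contains the commutators of A, which lie in A⁴. -/

/-! ### Pivot argument in the field. -/

section Pivot

open Finset

/-- Cauchy–Schwarz: a map with few collisions has a large image. -/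
lemma Finset.sq_card_le_card_image_mul_card_collisions {α β : Type*} [DecidableEq β]
    (s : Finset α) (f : α → β) :
    #s ^ 2 ≤ #(s.image f) * #{p ∈ s ×ˢ s | f p.1 = f p.2} := by
  have h1 : #{p ∈ s ×ˢ s | f p.1 = f p.2} = ∑ b ∈ s.image f, #{a ∈ s | f a = b} ^ 2 := by
    rw [card_eq_sum_card_fiberwise (f := fun p => f p.1) (t := s.image f)]
    · refine sum_congr rfl fun b _ => ?_
      rw [sq, ← card_product]
      congr 1
      ext ⟨x, y⟩
      simp only [mem_filter, mem_product]
      constructor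
      · rintro ⟨⟨⟨hx, hy⟩, h⟩, hb⟩
        exact ⟨⟨hx, hb⟩, hy, h ▸ hb⟩
      · rintro ⟨⟨hx, hb⟩, hy, h⟩
        exact ⟨⟨⟨hx, hy⟩, hb.trans h.symm⟩, hb⟩
    · intro p hp
      simp only [coe_filter, mem_product, Set.mem_ofPred_eq] at hp
      exact mem_coe.2 (mem_image_of_mem f hp.1.1)
  rw [h1, card_eq_sum_card_image f s]
  exact sq_sum_le_card_mul_sum_sq

/-- The finite set `S + X ξ`. -/
def dilateSum {F : Type*} [Field F] [DecidableEq F] (S X : Finset F) (ξ : F) : Finset F :=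
  (S ×ˢ X).image fun p => p.1 + p.2 * ξ

lemma mem_dilateSum {F : Type*} [Field F] [DecidableEq F] {S X : Finset F} {ξ t : F} :
    t ∈ dilateSum S X ξ ↔ ∃ s ∈ S, ∃ x ∈ X, s + x * ξ = t := by
  simp [dilateSum, and_assoc]

/-- Some `ξ ∈ V` makes `S + X ξ` about as large as it can be. -/
lemma exists_large_dilateSum {F : Type*} [Field F] [DecidableEq F] (S X V : Finset F)
    (hV : V.Nonempty) :
    ∃ ξ ∈ V, #S * #X * #V ≤ #(dilateSum S X ξ) * (#V + #S * #X) := by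
  set Q := S ×ˢ X with hQ
  have hQc : #Q = #S * #X := card_product _ _
  let E : F → ℕ := fun ξ => #{p ∈ Q ×ˢ Q | p.1.1 + p.1.2 * ξ = p.2.1 + p.2.2 * ξ}
  have hsum : ∑ ξ ∈ V, E ξ ≤ #Q * #V + #Q ^ 2 := by
    have hswap : ∑ ξ ∈ V, E ξ =
        ∑ p ∈ Q ×ˢ Q, #{ξ ∈ V | p.1.1 + p.1.2 * ξ = p.2.1 + p.2.2 * ξ} := by
      simp only [E, card_filter]
      exact sum_comm
    -- Distinct slopes collide at one ξ at most; equal slopes collide only for equal pairs, and then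
    -- at every ξ.
    have hle : ∀ p ∈ Q ×ˢ Q, #{ξ ∈ V | p.1.1 + p.1.2 * ξ = p.2.1 + p.2.2 * ξ} ≤
        (if p.1 = p.2 then #V else 0) + 1 := by
      rintro ⟨⟨a, x⟩, ⟨b, y⟩⟩ -
      by_cases hxy : x = y
      · subst hxy
        by_cases hab : a = b
        · subst hab
          simp
        · simp [hab]
      · have : ¬ ((a, x) = (b, y)) := fun h => hxy (Prod.ext_iff.1 h).2
        rw [if_neg this, zero_add, card_le_one]
        intro ξ hξ η hη
        simp only [mem_filter] at hξ hη
        have h3 : (x - y) * (ξ - η) = 0 := by linear_combination hξ.2 - hη.2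
        rcases mul_eq_zero.1 h3 with h | h
        · exact absurd (sub_eq_zero.1 h) hxy
        · exact sub_eq_zero.1 h
    rw [hswap]
    refine (sum_le_sum hle).trans ?_
    rw [sum_add_distrib, sum_product]
    simp [sq]
  -- If every image were small, Cauchy–Schwarz would push the total collision count above the bound
  -- `hsum`.
  by_contra! hcon
  have hQpos : 0 < #Q := by
    obtain ⟨ξ, hξ⟩ := hV
    have := hcon ξ hξ
    rw [← hQc] at this
    by_contra h0
    have h0 : #Q = 0 := by omega
    simp [h0] at this
  have hlt : ∀ ξ ∈ V, #Q * (#V + #Q) < E ξ * #V := by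
    intro ξ hξ
    have h1 : #Q ^ 2 ≤ #(dilateSum S X ξ) * E ξ :=
      sq_card_le_card_image_mul_card_collisions Q fun p => p.1 + p.2 * ξ
    have h2 := hcon ξ hξ
    rw [← hQc] at h2
    by_contra! h3
    have h4 : #(dilateSum S X ξ) * (E ξ * #V) ≤ #(dilateSum S X ξ) * (#Q * (#V + #Q)) :=
      Nat.mul_le_mul_left _ h3
    have h5 : #Q ^ 2 * #V ≤ #(dilateSum S X ξ) * E ξ * #V := Nat.mul_le_mul_right _ h1
    nlinarith
  have h6 := sum_lt_sum_of_nonempty hV hlt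
  rw [sum_const, smul_eq_mul, ← sum_mul] at h6
  have h7 := Nat.mul_le_mul_right (#V) hsum
  nlinarith

/-- In a finite subgroup, a subset with more than half of the elements sums to everything. -/
lemma AddSubgroup.exists_add_eq_of_card_lt {G : Type*} [AddCommGroup G]
    (V : AddSubgroup G) (W B : Finset G) (hW : ∀ v, v ∈ W ↔ v ∈ V) (hB : B ⊆ W)
    (hcard : #W < 2 * #B) {v : G} (hv : v ∈ V) : ∃ b ∈ B, ∃ b' ∈ B, b + b' = v := by
  classical
  have hinj : Function.Injective fun b : G => v - b := sub_right_injective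
  have hsub : B ∪ B.image (fun b => v - b) ⊆ W := by
    refine union_subset hB fun x hx => ?_
    obtain ⟨b, hb, rfl⟩ := mem_image.1 hx
    exact (hW _).2 (V.sub_mem hv ((hW _).1 (hB hb)))
  have h1 := card_le_card hsub
  have h2 := card_union_add_card_inter B (B.image fun b => v - b)
  rw [card_image_of_injective _ hinj] at h2
  -- B and v - B each fill more than half of V, so they meet.
  have h3 : 0 < #(B ∩ B.image fun b => v - b) := by omega
  obtain ⟨x, hx⟩ := card_pos.1 h3
  obtain ⟨hx1, hx2⟩ := mem_inter.1 hx
  obtain ⟨b, hb, rfl⟩ := mem_image.1 hx2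
  exact ⟨_, hx1, b, hb, by simp⟩

/-- The elements `ξ` at which `(s, x) ↦ s + x ξ` has a collision on `S × X` with distinct
second coordinates. -/
def IsNonPivot {F : Type*} [Field F] (S X : Finset F) (ξ : F) : Prop :=
  ∃ x ∈ X, ∃ y ∈ X, x ≠ y ∧ ∃ a ∈ S, ∃ b ∈ S, (y - x) * ξ = a - b

lemma card_dilateSum_of_not_isNonPivot {F : Type*} [Field F] [DecidableEq F] {S X : Finset F}
    {ξ : F} (h : ¬ IsNonPivot S X ξ) : #(dilateSum S X ξ) = #S * #X := by
  rw [dilateSum, card_image_of_injOn, card_product]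
  rintro ⟨a, x⟩ hax ⟨b, y⟩ hby hab
  simp only [coe_product, Set.mem_prod, mem_coe] at hax hby hab
  by_cases hxy : x = y
  · subst hxy
    simpa using hab
  · exact absurd ⟨x, hax.2, y, hby.2, hxy, a, hax.1, b, hby.1, by linear_combination -hab⟩ h

/-- A chain of symmetric sets `B k` which multiply like the powers of a set, acted upon by `X`. -/
structure IsActedChain {F : Type*} [Field F] (B : ℕ → Finset F) (X : Finset F) : Prop where
  zero_mem : ∀ k, 0 ∈ B k
  neg_mem : ∀ k, ∀ b ∈ B k, -b ∈ B k
  add_mem : ∀ j k, ∀ a ∈ B j, ∀ b ∈ B k, a + b ∈ B (j + k)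
  smul_mem : ∀ k, ∀ x ∈ X, ∀ b ∈ B k, x * b ∈ B (k + 2)

namespace IsActedChain

variable {F : Type*} [Field F] {B : ℕ → Finset F} {X : Finset F}

lemma mono (h : IsActedChain B X) {j k : ℕ} (hjk : j ≤ k) {b : F} (hb : b ∈ B j) : b ∈ B k := by
  obtain ⟨l, rfl⟩ := Nat.exists_eq_add_of_le hjk
  simpa using h.add_mem j l b hb 0 (h.zero_mem l)

lemma sub_mem (h : IsActedChain B X) {j k : ℕ} {a b : F} (ha : a ∈ B j) (hb : b ∈ B k) :
    a - b ∈ B (j + k) := by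
  rw [sub_eq_add_neg]
  exact h.add_mem _ _ _ ha _ (h.neg_mem _ _ hb)

lemma sub_mul_mem (h : IsActedChain B X) {k : ℕ} {x y b : F} (hx : x ∈ X) (hy : y ∈ X)
    (hb : b ∈ B k) : (y - x) * b ∈ B ((k + 2) + (k + 2)) := by
  rw [sub_mul]
  exact h.sub_mem (h.smul_mem _ _ hy _ hb) (h.smul_mem _ _ hx _ hb)

variable [DecidableEq F]

/-- If `(y - x) ξ` lies in the chain, then so does the dilate by `y - x` of `S + X ξ`. -/
lemma mul_dilateSum_subset (h : IsActedChain B X) {x y ξ : F} (hx : x ∈ X) (hy : y ∈ X)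
    (hξ : (y - x) * ξ ∈ B 20) :
    (dilateSum (B 4) X ξ).image (fun t => (y - x) * t) ⊆ B 34 := by
  intro t ht
  obtain ⟨r, hr, rfl⟩ := mem_image.1 ht
  obtain ⟨s, hs, z, hz, rfl⟩ := mem_dilateSum.1 hr
  have h1 : (y - x) * s ∈ B 12 := h.sub_mul_mem hx hy hs
  have h2 : z * ((y - x) * ξ) ∈ B 22 := h.smul_mem _ _ hz _ hξ
  have h3 := h.add_mem _ _ _ h1 _ h2
  convert h3 using 1
  ring

lemma card_dilateSum_le (h : IsActedChain B X) {x y ξ : F} (hx : x ∈ X) (hy : y ∈ X)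
    (hxy : x ≠ y) (hξ : (y - x) * ξ ∈ B 20) : #(dilateSum (B 4) X ξ) ≤ #(B 34) := by
  rw [← card_image_of_injective _ (mul_right_injective₀ (sub_ne_zero.2 hxy.symm))]
  exact card_le_card (h.mul_dilateSum_subset hx hy hξ)

/-- A pivot η has |B 4 + Xη| = |B 4||X| > |B 34|, which is impossible once (y - x)η ∈ B 20 for
distinct x, y in X. The collision at ξ, multiplied by z, supplies this for η = zξ. -/
lemma isNonPivot_mul (h : IsActedChain B X) (hc : #(B 34) < #(B 4) * #X) {z ξ : F} (hz : z ∈ X)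
    (hξ : IsNonPivot (B 4) X ξ) : IsNonPivot (B 4) X (z * ξ) := by
  by_contra hn
  obtain ⟨x, hx, y, hy, hxy, a, ha, b, hb, e⟩ := hξ
  have h1 : (y - x) * (z * ξ) ∈ B 20 := by
    have h2 : z * (a - b) ∈ B 10 := h.smul_mem 8 _ hz _ (h.sub_mem ha hb)
    rw [show (y - x) * (z * ξ) = z * (a - b) by rw [← e]; ring]
    exact h.mono (by norm_num) h2
  have := h.card_dilateSum_le hx hy hxy h1
  rw [card_dilateSum_of_not_isNonPivot hn] at this
  omega

lemma isNonPivot_add (h : IsActedChain B X) (hc : #(B 34) < #(B 4) * #X) {s ξ : F} (hs : s ∈ B 4)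
    (hξ : IsNonPivot (B 4) X ξ) : IsNonPivot (B 4) X (ξ + s) := by
  by_contra hn
  obtain ⟨x, hx, y, hy, hxy, a, ha, b, hb, e⟩ := hξ
  have h1 : (y - x) * (ξ + s) ∈ B 20 := by
    have h2 : (a - b) + (y - x) * s ∈ B 20 :=
      h.add_mem 8 12 _ (h.sub_mem ha hb) _ (h.sub_mul_mem hx hy hs)
    rw [mul_add, e]
    exact h2
  have := h.card_dilateSum_le hx hy hxy h1
  rw [card_dilateSum_of_not_isNonPivot hn] at this
  omega

/-- If every element of the finite additive group `V`, invariant under `X` and containing `B 4`,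
is a non-pivot, then `V` is contained in the chain. -/
lemma mem_of_forall_isNonPivot (h : IsActedChain B X) (hc : 2 * #(B 34) < #(B 4) * #X)
    (V : AddSubgroup F) (W : Finset F) (hW : ∀ v, v ∈ W ↔ v ∈ V)
    (hBV : ∀ b ∈ B 4, b ∈ V) (hXV : ∀ x ∈ X, ∀ v ∈ V, x * v ∈ V)
    (hnp : ∀ v ∈ V, IsNonPivot (B 4) X v) {v : F} (hv : v ∈ V) : v ∈ B 68 := by
  obtain ⟨ξ, hξ, hlarge⟩ :=
    exists_large_dilateSum (B 4) X W ⟨0, (hW 0).2 V.zero_mem⟩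
  have hξV := (hW ξ).1 hξ
  obtain ⟨x, hx, y, hy, hxy, a, ha, b, hb, e⟩ := hnp ξ hξV
  have hξ20 : (y - x) * ξ ∈ B 20 := by
    rw [e]
    exact h.mono (by norm_num) (h.sub_mem ha hb)
  have hle := h.card_dilateSum_le hx hy hxy hξ20
  -- Write n = |B 4||X|. The averaging bound gives at least half of min(n, |W|); n/2 is excluded
  -- because it exceeds |B 34|, which is where the factor 2 in `hc` is needed.
  have hWlt : #W < 2 * #(dilateSum (B 4) X ξ) := by
    by_contra! hcon
    have hpos : 0 < #W := card_pos.2 ⟨ξ, hξ⟩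
    rcases le_total (#(B 4) * #X) (#W) with h1 | h1 <;> nlinarith
  set D := (dilateSum (B 4) X ξ).image (fun t => (y - x) * t) with hD
  have hDc : #D = #(dilateSum (B 4) X ξ) :=
    card_image_of_injective _ (mul_right_injective₀ (sub_ne_zero.2 hxy.symm))
  have hDW : D ⊆ W := by
    intro t ht
    obtain ⟨r, hr, rfl⟩ := mem_image.1 ht
    obtain ⟨s, hs, z, hz, rfl⟩ := mem_dilateSum.1 hr
    have hm : s + z * ξ ∈ V := V.add_mem (hBV s hs) (hXV z hz ξ hξV)
    rw [hW, sub_mul]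
    exact V.sub_mem (hXV y hy _ hm) (hXV x hx _ hm)
  obtain ⟨b, hb, b', hb', rfl⟩ :=
    V.exists_add_eq_of_card_lt W D hW hDW (by rw [hDc]; exact hWlt) hv
  exact h.add_mem 34 34 _ (h.mul_dilateSum_subset hx hy hξ20 hb) _
    (h.mul_dilateSum_subset hx hy hξ20 hb')

end IsActedChain

end Pivot

/-! ### Upper triangular matrices and the diagonal character. -/

section UpperTriangular

open Matrix Matrix.GeneralLinearGroup
open scoped commutatorElement

variable {F : Type*} [Field F]

/-- The ratio of the diagonal entries: a character on the upper triangular group. -/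
def diagRatio (g : GL (Fin 2) F) : F := g 0 0 / g 1 1

lemma upperT2_diag_mul_ne_zero {g : GL (Fin 2) F} (hg : g ∈ upperT2 F) : g 0 0 * g 1 1 ≠ 0 := by
  have h := g.det_ne_zero
  rw [det_fin_two] at h
  have h0 : g 1 0 = 0 := hg
  simpa [h0] using h

lemma upperT2_zero_zero_ne_zero {g : GL (Fin 2) F} (hg : g ∈ upperT2 F) : g 0 0 ≠ 0 :=
  left_ne_zero_of_mul (upperT2_diag_mul_ne_zero hg)

lemma upperT2_one_one_ne_zero {g : GL (Fin 2) F} (hg : g ∈ upperT2 F) : g 1 1 ≠ 0 :=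
  right_ne_zero_of_mul (upperT2_diag_mul_ne_zero hg)

lemma diagRatio_one : diagRatio (1 : GL (Fin 2) F) = 1 := by
  simp [diagRatio]

lemma upperT2_mul_zero_zero {g h : GL (Fin 2) F} (hh : h ∈ upperT2 F) :
    (g * h) 0 0 = g 0 0 * h 0 0 := by
  have h0 : h 1 0 = 0 := hh
  simp [Matrix.mul_apply, Fin.sum_univ_two, h0]

lemma upperT2_mul_one_one {g h : GL (Fin 2) F} (hg : g ∈ upperT2 F) :
    (g * h) 1 1 = g 1 1 * h 1 1 := by
  have h0 : g 1 0 = 0 := hg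
  simp [Matrix.mul_apply, Fin.sum_univ_two, h0]

lemma diagRatio_mul {g h : GL (Fin 2) F} (hg : g ∈ upperT2 F) (hh : h ∈ upperT2 F) :
    diagRatio (g * h) = diagRatio g * diagRatio h := by
  rw [diagRatio, upperT2_mul_zero_zero hh, upperT2_mul_one_one hg, mul_div_mul_comm]
  rfl

lemma diagRatio_ne_zero {g : GL (Fin 2) F} (hg : g ∈ upperT2 F) : diagRatio g ≠ 0 :=
  div_ne_zero (upperT2_zero_zero_ne_zero hg) (upperT2_one_one_ne_zero hg)

lemma diagRatio_inv {g : GL (Fin 2) F} (hg : g ∈ upperT2 F) :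
    diagRatio g⁻¹ = (diagRatio g)⁻¹ := by
  refine eq_inv_of_mul_eq_one_left ?_
  rw [← diagRatio_mul (inv_mem hg) hg, inv_mul_cancel, diagRatio_one]

/-- Conjugation by an upper triangular matrix dilates the unipotent group. -/
lemma mul_upperRightHom_mul_inv {g : GL (Fin 2) F} (hg : g ∈ upperT2 F) (b : F) :
    g * upperRightHom b * g⁻¹ = upperRightHom (diagRatio g * b) := by
  have h0 : g 1 0 = 0 := hg
  have h1 := upperT2_one_one_ne_zero hg
  rw [mul_inv_eq_iff_eq_mul]
  ext i j
  fin_cases i <;> fin_cases j <;>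
    simp [Matrix.mul_apply, Fin.sum_univ_two, h0, diagRatio]
  field_simp
  ring

lemma upperRightHom_mem_unipotentU2 (b : F) : upperRightHom b ∈ unipotentU2 F := by
  refine ⟨show (upperRightHom b : GL (Fin 2) F) 1 0 = 0 by simp, fun i => ?_⟩
  fin_cases i <;> simp

lemma exists_upperRightHom_eq {g : GL (Fin 2) F} (hg : g ∈ unipotentU2 F) :
    ∃ b, upperRightHom b = g := by
  refine ⟨g 0 1, ?_⟩
  have h0 : g 1 0 = 0 := hg.1
  have h1 := hg.2 0
  have h2 := hg.2 1
  ext i j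
  fin_cases i <;> fin_cases j <;> simp [h0, h1, h2]

lemma commutator_mem_unipotentU2 {g h : GL (Fin 2) F} (hg : g ∈ upperT2 F) (hh : h ∈ upperT2 F) :
    ⁅g, h⁆ ∈ unipotentU2 F := by
  have hc : ⁅g, h⁆ ∈ upperT2 F :=
    mul_mem (mul_mem (mul_mem hg hh) (inv_mem hg)) (inv_mem hh)
  have e : ⁅g, h⁆ * (h * g) = g * h := by
    simp [commutatorElement_def, mul_assoc]
  have hhg := mul_mem hh hg
  refine ⟨hc, fun i => ?_⟩
  fin_cases i
  · have e0 : (⁅g, h⁆ * (h * g)) 0 0 = (g * h) 0 0 := by rw [e]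
    rw [upperT2_mul_zero_zero hhg, upperT2_mul_zero_zero hg, upperT2_mul_zero_zero hh] at e0
    refine mul_right_cancel₀ (mul_ne_zero (upperT2_zero_zero_ne_zero hh)
      (upperT2_zero_zero_ne_zero hg)) (?_ : ⁅g, h⁆ 0 0 * _ = 1 * _)
    rw [e0]
    ring
  · have e0 : (⁅g, h⁆ * (h * g)) 1 1 = (g * h) 1 1 := by rw [e]
    rw [upperT2_mul_one_one hc, upperT2_mul_one_one hg, upperT2_mul_one_one hh] at e0
    refine mul_right_cancel₀ (mul_ne_zero (upperT2_one_one_ne_zero hh)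
      (upperT2_one_one_ne_zero hg)) (?_ : ⁅g, h⁆ 1 1 * _ = 1 * _)
    rw [e0]
    ring

lemma isFStarPotent_iff {g : GL (Fin 2) F} :
    IsFStarPotent g ↔ g ∈ upperT2 F ∧ diagRatio g = 1 := by
  constructor
  · rintro ⟨c, hc, u, hu, e⟩
    have h10 : g 1 0 = 0 := by
      have : u 1 0 = 0 := hu.1
      rw [e]
      simp [this]
    refine ⟨h10, ?_⟩
    have h0 := hu.2 0
    have h1 := hu.2 1
    rw [diagRatio, e]
    simp [h0, h1, hc]
  · rintro ⟨hg, h⟩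
    have hne := upperT2_one_one_ne_zero hg
    have h00 : g 0 0 = g 1 1 := (div_eq_one_iff_eq hne).1 h
    have h10 : g 1 0 = 0 := hg
    refine ⟨g 1 1, hne, upperRightHom (g 0 1 / g 1 1), upperRightHom_mem_unipotentU2 _, ?_⟩
    ext i j
    fin_cases i <;> fin_cases j <;> simp [h00, h10, mul_div_cancel₀, hne]

variable (F) in
/-- The group of all `F^*`-potent matrices. -/
def fStarPotentGroup : Subgroup (GL (Fin 2) F) where
  carrier := {g | IsFStarPotent g}
  one_mem' := isFStarPotent_iff.2 ⟨one_mem _, diagRatio_one⟩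
  mul_mem' := by
    intro g h hg hh
    obtain ⟨hg, hg1⟩ := isFStarPotent_iff.1 hg
    obtain ⟨hh, hh1⟩ := isFStarPotent_iff.1 hh
    exact isFStarPotent_iff.2 ⟨mul_mem hg hh, by rw [diagRatio_mul hg hh, hg1, hh1, one_mul]⟩
  inv_mem' := by
    intro g hg
    obtain ⟨hg, hg1⟩ := isFStarPotent_iff.1 hg
    exact isFStarPotent_iff.2 ⟨inv_mem hg, by rw [diagRatio_inv hg, hg1, inv_one]⟩

end UpperTriangular

/-! ### Counting along the character and in the unipotent part. -/

section Growth

open Finset Matrix Matrix.GeneralLinearGroup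
open scoped commutatorElement

variable {F : Type*} [Field F] [DecidableEq F] {A : Finset (GL (Fin 2) F)}

/-- For a fixed g in a fibre of the character, h ↦ g⁻¹h injects that fibre into the F^*-potent part
of A². -/
lemma card_le_card_mul_card_image_diagRatio (hT : ∀ g ∈ A, g ∈ upperT2 F) (hA : A⁻¹ = A)
    (P : Finset (GL (Fin 2) F)) (hP : ∀ g ∈ A ^ 2, IsFStarPotent g → g ∈ P) :
    #A ≤ #P * #(A.image diagRatio) := by
  refine card_le_mul_card_image _ _ fun x hx => ?_
  obtain ⟨g, hg, rfl⟩ := mem_image.1 hx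
  refine card_le_card_of_injOn (fun h => g⁻¹ * h) (fun h hh => ?_)
    fun h _ h' _ e => mul_left_cancel e
  obtain ⟨hhA, hhr⟩ := mem_filter.1 hh
  refine hP _ ?_ (isFStarPotent_iff.2 ⟨mul_mem (inv_mem (hT g hg)) (hT h hhA), ?_⟩)
  · rw [sq]
    exact mul_mem_mul (by rw [← hA]; exact inv_mem_inv hg) hhA
  · rw [diagRatio_mul (inv_mem (hT g hg)) (hT h hhA), diagRatio_inv (hT g hg), hhr]
    exact inv_mul_cancel₀ (diagRatio_ne_zero (hT g hg))

variable [Fintype F]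

/-- The upper right entries of the unipotent matrices in `A ^ k`. -/
def unipotentEntries (A : Finset (GL (Fin 2) F)) (k : ℕ) : Finset F :=
  {b | upperRightHom b ∈ A ^ k}

lemma mem_unipotentEntries {k : ℕ} {b : F} :
    b ∈ unipotentEntries A k ↔ upperRightHom b ∈ A ^ k := by
  simp [unipotentEntries]

lemma isActedChain_unipotentEntries (hT : ∀ g ∈ A, g ∈ upperT2 F) (h1 : 1 ∈ A) (hA : A⁻¹ = A) :
    IsActedChain (unipotentEntries A) (A.image diagRatio) where
  zero_mem k := by
    rw [mem_unipotentEntries, AddChar.map_zero_eq_one]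
    exact one_mem_pow h1
  neg_mem k b hb := by
    rw [mem_unipotentEntries] at hb ⊢
    rw [AddChar.map_neg_eq_inv, ← hA, inv_pow]
    exact inv_mem_inv hb
  add_mem j k a ha b hb := by
    rw [mem_unipotentEntries] at ha hb ⊢
    rw [AddChar.map_add_eq_mul, pow_add]
    exact mul_mem_mul ha hb
  smul_mem k x hx b hb := by
    obtain ⟨g, hg, rfl⟩ := mem_image.1 hx
    rw [mem_unipotentEntries] at hb ⊢
    rw [← mul_upperRightHom_mul_inv (hT g hg), pow_succ, pow_succ']
    exact mul_mem_mul (mul_mem_mul hg hb) (by rw [← hA]; exact inv_mem_inv hg)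

/-- The unipotent part of `A` grows no faster than `A` itself. -/
lemma card_mul_card_unipotentEntries_le (hA : A⁻¹ = A) (k : ℕ) :
    #A * #(unipotentEntries A k) ≤ #(unipotentEntries A 2) * #(A ^ (k + 1)) := by
  set Q := A ×ˢ unipotentEntries A k
  let f : GL (Fin 2) F × F → GL (Fin 2) F := fun p => p.1 * upperRightHom p.2
  -- Two pairs with the same product differ by a unipotent element g⁻¹g' of A², so fibres of f have
  -- at most |B 2| elements.
  have h1 : #Q ≤ #(unipotentEntries A 2) * #(Q.image f) := by
    refine card_le_mul_card_image _ _ fun x hx => ?_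
    obtain ⟨⟨g, b⟩, hgb, rfl⟩ := mem_image.1 hx
    have key : ∀ p ∈ {q ∈ Q | f q = f (g, b)}, g⁻¹ * p.1 = upperRightHom (b - p.2) := by
      intro p hp
      have e : p.1 * upperRightHom p.2 = g * upperRightHom b := (mem_filter.1 hp).2
      rw [sub_eq_add_neg, AddChar.map_add_eq_mul, AddChar.map_neg_eq_inv, inv_mul_eq_iff_eq_mul, ← mul_assoc,
        eq_mul_inv_iff_mul_eq, e]
    refine card_le_card_of_injOn (fun p => b - p.2) (fun p hp => ?_) ?_
    · change b - p.2 ∈ unipotentEntries A 2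
      rw [mem_unipotentEntries, ← key p hp, sq]
      refine mul_mem_mul ?_ (mem_product.1 (mem_filter.1 hp).1).1
      rw [← hA]
      exact inv_mem_inv (mem_product.1 hgb).1
    · intro p hp q hq e
      have e2 : p.2 = q.2 := sub_right_injective e
      have e1 : g⁻¹ * p.1 = g⁻¹ * q.1 := by rw [key p hp, key q hq, e2]
      exact Prod.ext (mul_left_cancel e1) e2
  have h2 : Q.image f ⊆ A ^ (k + 1) := by
    intro x hx
    obtain ⟨⟨g, b⟩, hgb, rfl⟩ := mem_image.1 hx
    obtain ⟨hg, hb⟩ := mem_product.1 hgb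
    rw [pow_succ']
    exact mul_mem_mul hg (mem_unipotentEntries.1 hb)
  rw [← card_product]
  exact h1.trans (Nat.mul_le_mul_left _ (card_le_card h2))

end Growth

/-! ### Invariant spans and normal unipotent subgroups. -/

section NormalSubgroup

open Finset Matrix Matrix.GeneralLinearGroup
open scoped commutatorElement

variable {F : Type*} [Field F]

/-- The additive group generated by `S` under the action of a group of matrices. -/
def orbitSpan (G : Subgroup (GL (Fin 2) F)) (S : Set F) : AddSubgroup F :=
  AddSubgroup.closure {v | ∃ g ∈ G, ∃ s ∈ S, diagRatio g * s = v}

lemma subset_orbitSpan (G : Subgroup (GL (Fin 2) F)) (S : Set F) {s : F} (hs : s ∈ S) :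
    s ∈ orbitSpan G S :=
  AddSubgroup.subset_closure ⟨1, one_mem _, s, hs, by rw [diagRatio_one, one_mul]⟩

lemma diagRatio_mul_mem_orbitSpan {G : Subgroup (GL (Fin 2) F)} (hG : G ≤ upperT2 F) (S : Set F)
    {g : GL (Fin 2) F} (hg : g ∈ G) {v : F} (hv : v ∈ orbitSpan G S) :
    diagRatio g * v ∈ orbitSpan G S := by
  induction hv using AddSubgroup.closure_induction with
  | mem v hv =>
    obtain ⟨h, hh, s, hs, rfl⟩ := hv
    rw [← mul_assoc, ← diagRatio_mul (hG hg) (hG hh)]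
    exact AddSubgroup.subset_closure ⟨g * h, mul_mem hg hh, s, hs, rfl⟩
  | zero => simp
  | add v w _ _ hv hw => rw [mul_add]; exact add_mem hv hw
  | neg v _ hv => rw [mul_neg]; exact neg_mem hv

/-- A property preserved by the action and by translations by `S` is preserved by translations by
the orbit span of `S`. -/
lemma orbitSpan_induction {A : Set (GL (Fin 2) F)} (hT : Subgroup.closure A ≤ upperT2 F)
    (hA : A⁻¹ = A) {S : Set F} (hS : ∀ s ∈ S, -s ∈ S) {p : F → Prop} (h0 : p 0)
    (hmul : ∀ g ∈ A, ∀ v, p v → p (diagRatio g * v)) (hadd : ∀ s ∈ S, ∀ v, p v → p (v + s))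
    {v : F} (hv : v ∈ orbitSpan (Subgroup.closure A) S) : p v := by
  -- The equivalence, rather than one implication, is what lets the induction pass to inverses.
  have hact : ∀ g ∈ Subgroup.closure A, ∀ v, p v ↔ p (diagRatio g * v) := by
    intro g hg
    induction hg using Subgroup.closure_induction with
    | mem g hg =>
      refine fun v => ⟨hmul g hg v, fun h => ?_⟩
      have hgT := hT (Subgroup.subset_closure hg)
      have h' := hmul g⁻¹ (by rw [← hA]; exact Set.inv_mem_inv.2 hg) _ h
      rwa [diagRatio_inv hgT, inv_mul_cancel_left₀ (diagRatio_ne_zero hgT)] at h'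
    | one => simp [diagRatio_one]
    | mul g h hg hh ihg ihh =>
      intro v
      rw [diagRatio_mul (hT hg) (hT hh), mul_assoc, ← ihg, ← ihh]
    | inv g hg ih =>
      intro v
      rw [ih (diagRatio g⁻¹ * v), diagRatio_inv (hT hg),
        mul_inv_cancel_left₀ (diagRatio_ne_zero (hT hg))]
  have htr : ∀ g ∈ Subgroup.closure A, ∀ s ∈ S, ∀ v, p v → p (v + diagRatio g * s) := by
    intro g hg s hs v hv
    have h1 := (hact g⁻¹ (inv_mem hg) v).1 hv
    have h2 := (hact g hg _).1 (hadd s hs _ h1)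
    rwa [diagRatio_inv (hT hg), mul_add,
      mul_inv_cancel_left₀ (diagRatio_ne_zero (hT hg))] at h2
  have hall : ∀ w, p w ↔ p (w + v) := by
    induction hv using AddSubgroup.closure_induction with
    | mem v hv =>
      obtain ⟨g, hg, s, hs, rfl⟩ := hv
      refine fun w => ⟨htr g hg s hs w, fun h => ?_⟩
      simpa using htr g hg (-s) (hS s hs) _ h
    | zero => simp
    | add v w _ _ hv hw =>
      intro x
      rw [hv, hw, add_assoc]
    | neg v _ hv =>
      intro x
      rw [hv (x + -v), neg_add_cancel_right]
  simpa using (hall 0).1 h0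

/-- The unipotent matrices with upper right entry in `V`. -/
def unipotentOf (V : AddSubgroup F) : Subgroup (GL (Fin 2) F) where
  carrier := {g | ∃ v ∈ V, upperRightHom v = g}
  one_mem' := ⟨0, V.zero_mem, AddChar.map_zero_eq_one _⟩
  mul_mem' := by
    rintro _ _ ⟨v, hv, rfl⟩ ⟨w, hw, rfl⟩
    exact ⟨v + w, V.add_mem hv hw, AddChar.map_add_eq_mul _ _ _⟩
  inv_mem' := by
    rintro _ ⟨v, hv, rfl⟩
    exact ⟨-v, V.neg_mem hv, AddChar.map_neg_eq_inv _ _⟩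

lemma mem_unipotentOf {V : AddSubgroup F} {g : GL (Fin 2) F} :
    g ∈ unipotentOf V ↔ ∃ v ∈ V, upperRightHom v = g :=
  Iff.rfl

/-- If `U` is normalised by `⟨A⟩` and contains the commutators of elements of `A`, then it contains
all commutators of `⟨A⟩`. -/
lemma commutator_mem_of_closure {G : Type*} [Group G] {A : Set G} {U : Subgroup G}
    (hn : ∀ g ∈ Subgroup.closure A, ∀ u ∈ U, g * u * g⁻¹ ∈ U)
    (hc : ∀ g ∈ A, ∀ h ∈ A, ⁅g, h⁆ ∈ U) {g h : G} (hg : g ∈ Subgroup.closure A)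
    (hh : h ∈ Subgroup.closure A) : ⁅g, h⁆ ∈ U := by
  have step : ∀ k, (∀ g ∈ A, ⁅g, k⁆ ∈ U) → ∀ g ∈ Subgroup.closure A, ⁅g, k⁆ ∈ U := by
    intro k hk g hg
    induction hg using Subgroup.closure_induction with
    | mem g hg => exact hk g hg
    | one => simp
    | mul g h hg hh ihg ihh =>
      have e : ⁅g * h, k⁆ = g * ⁅h, k⁆ * g⁻¹ * ⁅g, k⁆ := by
        simp only [commutatorElement_def]
        group
      rw [e]
      exact mul_mem (hn g hg _ ihh) ihg
    | inv g hg ih =>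
      have e : ⁅g⁻¹, k⁆ = g⁻¹ * ⁅g, k⁆⁻¹ * g⁻¹⁻¹ := by
        simp only [commutatorElement_def]
        group
      rw [e]
      exact hn _ (inv_mem hg) _ (inv_mem ih)
  refine step h (fun g hg => ?_) g hg
  rw [← commutatorElement_inv]
  exact inv_mem (step g (fun k hk => hc k hk g hg) h hh)

lemma closure_le_upperT2 {A : Finset (GL (Fin 2) F)} (hT : ∀ g ∈ A, g ∈ upperT2 F) :
    Subgroup.closure (A : Set (GL (Fin 2) F)) ≤ upperT2 F :=
  (Subgroup.closure_le _).2 hT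

end NormalSubgroup

/-! ### Assembling the dichotomy. -/

section Main

open Finset Matrix Matrix.GeneralLinearGroup
open scoped commutatorElement

variable {F : Type*} [Field F] [Fintype F] [DecidableEq F] {A : Finset (GL (Fin 2) F)}

/-- A commutator is a four-letter word in A, which is why the span is built from index 4. -/
lemma commutator_mem_unipotentOf_orbitSpan (hT : ∀ g ∈ A, g ∈ upperT2 F) (hA : A⁻¹ = A)
    {g h : GL (Fin 2) F} (hg : g ∈ A) (hh : h ∈ A) :
    ⁅g, h⁆ ∈ unipotentOf (orbitSpan (Subgroup.closure (A : Set (GL (Fin 2) F)))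
      (unipotentEntries A 4)) := by
  obtain ⟨b, hb⟩ := exists_upperRightHom_eq (commutator_mem_unipotentU2 (hT g hg) (hT h hh))
  refine ⟨b, subset_orbitSpan _ _ ?_, hb⟩
  rw [mem_coe, mem_unipotentEntries, hb, commutatorElement_def, pow_succ, pow_succ, sq]
  have hi : ∀ g ∈ A, g⁻¹ ∈ A := fun g hg => by rw [← hA]; exact inv_mem_inv hg
  exact mul_mem_mul (mul_mem_mul (mul_mem_mul hg hh) (hi g hg)) (hi h hh)

/-- If `A` has many diagonal ratios in comparison to the growth of its unipotent part, then the
orbit span of its unipotent part is contained in a bounded power of `A`. -/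
lemma orbitSpan_subset_unipotentEntries (hT : ∀ g ∈ A, g ∈ upperT2 F) (h1 : 1 ∈ A) (hA : A⁻¹ = A)
    (hc : 2 * #(unipotentEntries A 34) < #(unipotentEntries A 4) * #(A.image diagRatio)) :
    ∀ v ∈ orbitSpan (Subgroup.closure (A : Set (GL (Fin 2) F))) (unipotentEntries A 4),
      v ∈ unipotentEntries A 68 := by
  classical
  intro v hv
  have hB := isActedChain_unipotentEntries hT h1 hA
  have hTc := closure_le_upperT2 hT
  set V := orbitSpan (Subgroup.closure (A : Set (GL (Fin 2) F)))
    (unipotentEntries A 4 : Set F) with hVdef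
  have hc' : #(unipotentEntries A 34) < #(unipotentEntries A 4) * #(A.image diagRatio) := by omega
  have hle : #(unipotentEntries A 4) ≤ #(unipotentEntries A 34) :=
    card_le_card fun b hb => hB.mono (by norm_num) hb
  have hX : 1 < #(A.image diagRatio) := by
    by_contra! h
    have := Nat.mul_le_mul_left (#(unipotentEntries A 4)) h
    omega
  have hnp : ∀ v ∈ V, IsNonPivot (unipotentEntries A 4) (A.image diagRatio) v := by
    intro v hv
    refine orbitSpan_induction hTc (by exact_mod_cast hA)
      (fun s hs => hB.neg_mem 4 s hs) ?_ ?_ ?_ hv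
    -- Zero is a non-pivot as soon as X has two elements.
    · obtain ⟨x, hx, y, hy, hxy⟩ := one_lt_card.1 hX
      exact ⟨x, hx, y, hy, hxy, 0, hB.zero_mem 4, 0, hB.zero_mem 4, by simp⟩
    · exact fun g hg v hv => hB.isNonPivot_mul hc' (mem_image_of_mem _ hg) hv
    · exact fun s hs v hv => hB.isNonPivot_add hc' hs hv
  refine hB.mem_of_forall_isNonPivot hc V (univ.filter (· ∈ V)) (by simp)
    (fun b hb => subset_orbitSpan _ _ hb) (fun x hx v hv => ?_) hnp hv
  obtain ⟨g, hg, rfl⟩ := mem_image.1 hx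
  exact diagRatio_mul_mem_orbitSpan hTc _ (Subgroup.subset_closure hg) hv

/-- Small tripling bounds the growth of the unipotent part. -/
lemma card_unipotentEntries_le {K : ℝ} (h1 : 1 ∈ A) (hA : A⁻¹ = A)
    (hK : (#(A ^ 3) : ℝ) ≤ K * #A) :
    (#(unipotentEntries A 34) : ℝ) ≤ K ^ 33 * #(unipotentEntries A 4) := by
  have hpos : (0 : ℝ) < #A := by exact_mod_cast card_pos.2 ⟨1, h1⟩
  -- Tripling K bounds |A^n| by K^(n-2)|A|; here n = 34 + 1.
  have hg : (#(A ^ 35) : ℝ) ≤ K ^ 33 * #A := small_pow_of_small_tripling (by norm_num) hK hA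
  have h2 : (#A : ℝ) * #(unipotentEntries A 34) ≤ #(unipotentEntries A 2) * #(A ^ 35) := by
    exact_mod_cast card_mul_card_unipotentEntries_le hA 34
  have h3 : (#(unipotentEntries A 2) : ℝ) ≤ #(unipotentEntries A 4) := by
    refine mod_cast card_le_card fun b hb => ?_
    rw [mem_unipotentEntries] at hb ⊢
    exact pow_subset_pow_right h1 (by norm_num) hb
  refine le_of_mul_le_mul_left ?_ hpos
  calc (#A : ℝ) * #(unipotentEntries A 34)
      ≤ #(unipotentEntries A 2) * #(A ^ 35) := h2
    _ ≤ #(unipotentEntries A 4) * (K ^ 33 * #A) :=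
      mul_le_mul h3 hg (Nat.cast_nonneg _) (Nat.cast_nonneg _)
    _ = #A * (K ^ 33 * #(unipotentEntries A 4)) := by ring

end Main

theorem theorem1 :
    ∃ (c : ℝ) (C m : ℕ), 0 < c ∧
      ∀ (F : Type*) [Field F] [Finite F] (A : Set (GL (Fin 2) F)) (K : ℝ),
        A ⊆ (upperT2 F : Set (GL (Fin 2) F)) →
        1 ∈ A →
        A⁻¹ = A →
        ((A ^ 3).ncard : ℝ) ≤ K * (A.ncard : ℝ) →
        (∃ H : Subgroup (GL (Fin 2) F), IsFStarPotentGroup H ∧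
          c * (K ^ C)⁻¹ * (A.ncard : ℝ) ≤ ((A ^ 2 ∩ (H : Set (GL (Fin 2) F))).ncard : ℝ)) ∨
        (∃ U : Subgroup (GL (Fin 2) F), U ≤ unipotentU2 F ∧
          (U : Set (GL (Fin 2) F)) ⊆ A ^ m ∧
          ∃ _ : (U.subgroupOf (Subgroup.closure A)).Normal,
            ∀ x y : Subgroup.closure A ⧸ U.subgroupOf (Subgroup.closure A), x * y = y * x) := by
  classical
  -- The exponent 33 is the tripling loss at A^35, 1/2 pays for the factor 2 in the pivot condition,
  -- and 68 = 34 + 34.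
  refine ⟨1 / 2, 33, 68, by norm_num, fun F _ _ A' K hT' h1' hA' hK' => ?_⟩
  have : Fintype F := Fintype.ofFinite F
  obtain ⟨A, rfl⟩ : ∃ A : Finset (GL (Fin 2) F), (A : Set (GL (Fin 2) F)) = A' :=
    ⟨A'.toFinite.toFinset, by simp⟩
  have hT : ∀ g ∈ A, g ∈ upperT2 F := hT'
  have h1 : 1 ∈ A := h1'
  have hA : A⁻¹ = A := by exact_mod_cast hA'
  have hK : ((A ^ 3).card : ℝ) ≤ K * A.card := by
    rwa [← Finset.coe_pow, Set.ncard_coe_finset, Set.ncard_coe_finset] at hK'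
  refine or_iff_not_imp_left.2 fun hsmall => ?_
  push Not at hsmall
  have hH := hsmall (fStarPotentGroup F) rfl
  set P : Finset (GL (Fin 2) F) := (A ^ 2).filter (· ∈ fStarPotentGroup F) with hP
  have hPc : ((A : Set (GL (Fin 2) F)) ^ 2 ∩ (fStarPotentGroup F : Set (GL (Fin 2) F))) = P := by
    rw [hP, Finset.coe_filter, ← Finset.coe_pow]
    rfl
  rw [hPc, Set.ncard_coe_finset, Set.ncard_coe_finset] at hH
  have hApos : (0 : ℝ) < A.card := by exact_mod_cast Finset.card_pos.2 ⟨1, h1⟩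
  have hKpos : 0 < K := by
    have h3 : (0 : ℝ) < (A ^ 3).card := by
      exact_mod_cast Finset.card_pos.2 ⟨1, Finset.one_mem_pow h1⟩
    exact pos_of_mul_pos_left (h3.trans_le hK) hApos.le
  have hcount : (A.card : ℝ) ≤ P.card * (A.image diagRatio).card := by
    exact_mod_cast card_le_card_mul_card_image_diagRatio hT hA P
      fun g hg hp => Finset.mem_filter.2 ⟨hg, hp⟩
  have hXpos : (0 : ℝ) < (A.image diagRatio).card := by
    exact_mod_cast Finset.card_pos.2 ⟨_, Finset.mem_image_of_mem _ h1⟩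
  have hX : 2 * K ^ 33 < (A.image diagRatio).card := by
    have h2 : (A.card : ℝ) < 1 / 2 * (K ^ 33)⁻¹ * A.card * (A.image diagRatio).card :=
      hcount.trans_lt (mul_lt_mul_of_pos_right hH hXpos)
    have hKp : (0 : ℝ) < K ^ 33 := pow_pos hKpos _
    have h3 : (A.card : ℝ) * (2 * K ^ 33) < (A.card : ℝ) * (A.image diagRatio).card := by
      calc (A.card : ℝ) * (2 * K ^ 33)
          < 1 / 2 * (K ^ 33)⁻¹ * A.card * (A.image diagRatio).card * (2 * K ^ 33) := by gcongr
        _ = (A.card : ℝ) * (A.image diagRatio).card := by field_simp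
    exact lt_of_mul_lt_mul_left h3 hApos.le
  have hc : 2 * (unipotentEntries A 34).card <
      (unipotentEntries A 4).card * (A.image diagRatio).card := by
    have hS : (0 : ℝ) < (unipotentEntries A 4).card := by
      exact_mod_cast Finset.card_pos.2 ⟨0, (isActedChain_unipotentEntries hT h1 hA).zero_mem 4⟩
    have h2 := card_unipotentEntries_le h1 hA hK
    have h3 := mul_lt_mul_of_pos_left hX hS
    have h4 : (2 : ℝ) * (unipotentEntries A 34).card <
        (unipotentEntries A 4).card * (A.image diagRatio).card := by linarith
    exact_mod_cast h4
  set G := Subgroup.closure (A : Set (GL (Fin 2) F)) with hG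
  set U := unipotentOf (orbitSpan G (unipotentEntries A 4 : Set F)) with hU
  have hTc : G ≤ upperT2 F := closure_le_upperT2 hT
  have hn : ∀ g ∈ G, ∀ u ∈ U, g * u * g⁻¹ ∈ U := by
    rintro g hg _ ⟨v, hv, rfl⟩
    exact ⟨_, diagRatio_mul_mem_orbitSpan hTc _ hg hv, (mul_upperRightHom_mul_inv (hTc hg) v).symm⟩
  refine ⟨U, ?_, ?_, ⟨fun u hu g => hn g g.2 u hu⟩, ?_⟩
  · rintro _ ⟨v, -, rfl⟩
    exact upperRightHom_mem_unipotentU2 v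
  · intro g hg
    obtain ⟨v, hv, rfl⟩ := mem_unipotentOf.1 hg
    rw [← Finset.coe_pow, Finset.mem_coe, ← mem_unipotentEntries]
    exact orbitSpan_subset_unipotentEntries hT h1 hA hc v hv
  · intro x y
    induction x using QuotientGroup.induction_on with | _ x
    induction y using QuotientGroup.induction_on with | _ y
    rw [← QuotientGroup.mk_mul, ← QuotientGroup.mk_mul, QuotientGroup.eq, Subgroup.mem_subgroupOf]
    have := commutator_mem_of_closure hn
      (fun g hg h hh => commutator_mem_unipotentOf_orbitSpan hT hA hg hh)
      (inv_mem y.2) (inv_mem x.2)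
    simpa [commutatorElement_def, mul_assoc] using this
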